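/- \textbf{Theorem.} Consider Dueck's deterministic multiple access channel (MAC): the input alphabets are $\mathcal X_1=\{a,b,A,B\}$ and $\mathcal X_2=\{0,1\}$, the output alphabet is $\mathcal Y=\{a,b,c,A,B,C\}\times\{0,1\}$, and inputs $(x_1,x_2)$ produce with probability $1$ the output $$W(x_1,x_2)=\begin{cases}(c,0) & (x_1,x_2)\in\{(a,0),(b,0)\},\\ (C,1) & (x_1,x_2)\in\{(A,1),(B,1)\},\\ (x_1,x_2) & \text{otherwise;}\end{cases}$$ the channel is used without memory. For real $x\ge 1$ write $[x]=\{1,\dots,\lfloor x\rfloor\}$. For a blocklength $n$, rates $R_1,R_2\ge 0$, input-link capacities $\mathbf C_{\rm in}=(C_{\rm in}^1,C_{\rm in}^2)$ and output-link alphabets $Z_1,Z_2$, a code with a cooperation facilitator (CF) consists of maps $\varphi_i\colon[2^{nR_i}]\to[2^{nC_{\rm in}^i}]$, $\psi_i\colon[2^{nC_{\rm in}^1}]\times[2^{nC_{\rm in}^2}]\to Z_i$, $f_i\colon[2^{nR_i}]\times Z_i\to\mathcal X_i^n$ (for $i=1,2$) and $g\colon\mathcal Y^n\to[2^{nR_1}]\times[2^{nR_2}]$.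 For a message pair $(w_1,w_2)$ put $z_i=\psi_i(\varphi_1(w_1),\varphi_2(w_2))$; the inputs $f_1(w_1,z_1)$, $f_2(w_2,z_2)$ are sent over the channel, and the error probability of $(w_1,w_2)$ is the probability that $g$ applied to the channel output differs from $(w_1,w_2)$. The pair $(R_1,R_2)$ is achievable under the maximal-error criterion if there is a sequence of such codes, one for each $n$, whose maximum over $(w_1,w_2)$ of the error probability tends to $0$ as $n\to\infty$. The maximal-error capacity region is the closure of the set of achievable pairs, and the maximal-error sum-capacity is the maximum of $R_1+R_2$ over this region. It is denoted $C_{\rm sum,max}(\mathbf C_{\rm in},\mathbf C_{\rm out})$ when $Z_i=[2^{nC_{\rm out}^i}]$, and $C_{\rm sum,max}(\mathbf C_{\rm in},k/n)$ when $Z_1=Z_2=[2^k]$ with $k$ a fixed integer, independent of $n$. Let $\mathbf C_{\rm in}^*=(C_{\rm in}^{*1},C_{\rm in}^{*2})$ satisfy $C_{\rm in}^{*1}\ge\log_2|\mathcal X_1|=2$ and $C_{\rm in}^{*2}\ge\log_2|\mathcal X_2|=1$, so that the CF can have full access to both messages. Then both sum-capacities below exist (the maxima are attained), and for $k=6$ $$C_{\rm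 sum,max}(\mathbf C_{\rm in}^*,k/n)>C_{\rm sum,max}(\mathbf C_{\rm in}^*,\mathbf 0).$$ -/

import Mathlib

open Filter Topology

noncomputable section

/-- A discrete memoryless multiple access channel with two encoders: `p x₁ x₂ y` is the conditional
probability of the output `y` given the inputs `x₁`, `x₂`. -/
structure DiscreteMAC (X₁ X₂ Y : Type) [Fintype Y] where
  p : X₁ → X₂ → Y → ℝ
  nonneg : ∀ x₁ x₂ y, 0 ≤ p x₁ x₂ y
  sum_eq_one : ∀ x₁ x₂, ∑ y, p x₁ x₂ y = 1

/-- The `n`-th memoryless extension of a MAC. -/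
def DiscreteMAC.ext {X₁ X₂ Y : Type} [Fintype Y] (W : DiscreteMAC X₁ X₂ Y) {n : ℕ}
    (x₁ : Fin n → X₁) (x₂ : Fin n → X₂) (y : Fin n → Y) : ℝ :=
  ∏ t, W.p (x₁ t) (x₂ t) (y t)

/-- A blocklength-`n` code for a MAC with a cooperation facilitator (CF). Encoder `i` has `Mᵢ`
messages, its link to the CF carries one of `Lᵢ` symbols, and the link from the CF to it carries
one of `Kᵢ` symbols. -/
structure CFCode (X₁ X₂ Y : Type) (n M₁ M₂ L₁ L₂ K₁ K₂ : ℕ) where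
  /-- what encoder 1 sends to the CF -/
  φ₁ : Fin M₁ → Fin L₁
  /-- what encoder 2 sends to the CF -/
  φ₂ : Fin M₂ → Fin L₂
  /-- what the CF sends to encoder 1 -/
  ψ₁ : Fin L₁ → Fin L₂ → Fin K₁
  /-- what the CF sends to encoder 2 -/
  ψ₂ : Fin L₁ → Fin L₂ → Fin K₂
  /-- codeword selection at encoder 1 -/
  f₁ : Fin M₁ → Fin K₁ → (Fin n → X₁)
  /-- codeword selection at encoder 2 -/
  f₂ : Fin M₂ → Fin K₂ → (Fin n → X₂)
  /-- the decoder -/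
  g : (Fin n → Y) → Fin M₁ × Fin M₂

namespace CFCode

variable {X₁ X₂ Y : Type} [Fintype Y] {n M₁ M₂ L₁ L₂ K₁ K₂ : ℕ}

/-- The probability of decoding the message pair `w` incorrectly. -/
def errorProb (c : CFCode X₁ X₂ Y n M₁ M₂ L₁ L₂ K₁ K₂) (W : DiscreteMAC X₁ X₂ Y)
    (w : Fin M₁ × Fin M₂) : ℝ :=
  ∑ y : Fin n → Y,
    if c.g y ≠ w then
      W.ext (c.f₁ w.1 (c.ψ₁ (c.φ₁ w.1) (c.φ₂ w.2))) (c.f₂ w.2 (c.ψ₂ (c.φ₁ w.1) (c.φ₂ w.2))) y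
    else 0

/-- The maximal error probability (a maximum over finitely many message pairs). -/
def maxError (c : CFCode X₁ X₂ Y n M₁ M₂ L₁ L₂ K₁ K₂) (W : DiscreteMAC X₁ X₂ Y) : ℝ :=
  ⨆ w : Fin M₁ × Fin M₂, c.errorProb W w

end CFCode

/-- The number of elements `⌊2 ^ (n R)⌋` of the set `[2 ^ (n R)] = {1, …, ⌊2 ^ (n R)⌋}`. -/
def rateSize (R : ℝ) (n : ℕ) : ℕ := ⌊(2 : ℝ) ^ ((n : ℝ) * R)⌋₊

/-- The rate pair `R` is achievable under the maximal-error criterion with a CF whose input links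
have capacities `Cin` and whose output links carry, at blocklength `n`, one of `K₁ n`, `K₂ n`
symbols. (The blocklength `n = 0` is vacuous: all sets involved are non-empty, so a code exists.) -/
def IsAchievableMax {X₁ X₂ Y : Type} [Fintype Y] (W : DiscreteMAC X₁ X₂ Y)
    (Cin : ℝ × ℝ) (K₁ K₂ : ℕ → ℕ) (R : ℝ × ℝ) : Prop :=
  0 ≤ R.1 ∧ 0 ≤ R.2 ∧
    ∃ c : ∀ n : ℕ, CFCode X₁ X₂ Y n (rateSize R.1 n) (rateSize R.2 n)
        (rateSize Cin.1 n) (rateSize Cin.2 n) (K₁ n) (K₂ n),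
      Tendsto (fun n => (c n).maxError W) atTop (𝓝 0)

/-- The maximal-error capacity region with a `(Cin, Cout)`-CF. -/
def capacityRegionMax {X₁ X₂ Y : Type} [Fintype Y] (W : DiscreteMAC X₁ X₂ Y)
    (Cin Cout : ℝ × ℝ) : Set (ℝ × ℝ) :=
  closure {R | IsAchievableMax W Cin (rateSize Cout.1) (rateSize Cout.2) R}

/-- The maximal-error capacity region with a `(Cin, k/n)`-CF: at every blocklength, the CF sends
`k` bits to each encoder. -/
def capacityRegionMaxBits {X₁ X₂ Y : Type} [Fintype Y] (W : DiscreteMAC X₁ X₂ Y)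
    (Cin : ℝ × ℝ) (k : ℕ) : Set (ℝ × ℝ) :=
  closure {R | IsAchievableMax W Cin (fun _ => 2 ^ k) (fun _ => 2 ^ k) R}

/-- The set of sum-rates `R₁ + R₂` of the rate pairs of a region. -/
def sumRates (S : Set (ℝ × ℝ)) : Set ℝ := (fun R : ℝ × ℝ => R.1 + R.2) '' S

/-- The maximal-error sum-capacity with a `(Cin, Cout)`-CF. -/
def sumCapacityMax {X₁ X₂ Y : Type} [Fintype Y] (W : DiscreteMAC X₁ X₂ Y)
    (Cin Cout : ℝ × ℝ) : ℝ :=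
  sSup (sumRates (capacityRegionMax W Cin Cout))

/-- The maximal-error sum-capacity with a `(Cin, k/n)`-CF. -/
def sumCapacityMaxBits {X₁ X₂ Y : Type} [Fintype Y] (W : DiscreteMAC X₁ X₂ Y)
    (Cin : ℝ × ℝ) (k : ℕ) : ℝ :=
  sSup (sumRates (capacityRegionMaxBits W Cin k))

/-- The first input alphabet `{a, b, A, B}` of Dueck's MAC; the second one is `{0, 1} = Fin 2`. -/
inductive DueckInput : Type
  | a | b | A | B
  deriving DecidableEq

instance : Fintype DueckInput where
  elems := {.a, .b, .A, .B}
  complete x := by cases x <;> simp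

/-- The first component `{a, b, c, A, B, C}` of the output alphabet of Dueck's MAC. -/
inductive DueckOutput : Type
  | a | b | c | A | B | C
  deriving DecidableEq

instance : Fintype DueckOutput where
  elems := {.a, .b, .c, .A, .B, .C}
  complete x := by cases x <;> simp

/-- The inclusion of `{a, b, A, B}` in `{a, b, c, A, B, C}`. -/
def DueckInput.toOutput : DueckInput → DueckOutput
  | .a => .a
  | .b => .b
  | .A => .A
  | .B => .B

/-- The deterministic map of Dueck's MAC. -/
def dueckMap (x₁ : DueckInput) (x₂ : Fin 2) : DueckOutput × Fin 2 :=
  if (x₁ = .a ∨ x₁ = .b) ∧ x₂ = 0 then (.c, 0)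
  else if (x₁ = .A ∨ x₁ = .B) ∧ x₂ = 1 then (.C, 1)
  else (x₁.toOutput, x₂)

/-- Dueck's MAC. -/
def dueckMAC : DiscreteMAC DueckInput (Fin 2) (DueckOutput × Fin 2) where
  p x₁ x₂ y := if y = dueckMap x₁ x₂ then 1 else 0
  nonneg x₁ x₂ y := by split_ifs <;> norm_num
  sum_eq_one x₁ x₂ := by simp

end

/-! The channel is deterministic, so each error probability is 0 or 1 and a small maximal error
means zero error: distinct message pairs have distinct output words.

Without cooperation the inputs form a product set. Induction on the blocklength, splitting both
codebooks by first letter, bounds the number of message pairs by (9/2)^n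
(`card_mul_card_le_of_injOn`), so the sum-rate is at most log₂(9/2) ≈ 2.17.

With a facilitator, encoder 2 uses any injective code, which the receiver always reads. A random
codebook of encoder 1 leaves a given message pair ambiguous with probability at most M₁(3/8)^n.
Among 64 independent codebooks, all fail for some pair with probability below 1, so a fixed list of
64 serves every pair. Six bits name a working codebook to encoder 1, which repeats them to the
receiver in six extra letters. This achieves (5/4, 19/20), of sum 2.2. -/

/-! ### Zero error from small maximal error -/

/-- The output word of Dueck's MAC. -/
def dueckOutput {n : ℕ} (x₁ : Fin n → DueckInput) (x₂ : Fin n → Fin 2) :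
    Fin n → DueckOutput × Fin 2 :=
  fun t => dueckMap (x₁ t) (x₂ t)

theorem dueckMAC_ext {n : ℕ} (x₁ : Fin n → DueckInput) (x₂ : Fin n → Fin 2)
    (y : Fin n → DueckOutput × Fin 2) :
    dueckMAC.ext x₁ x₂ y = if y = dueckOutput x₁ x₂ then 1 else 0 := by
  simp only [DiscreteMAC.ext, dueckMAC, dueckOutput, Finset.prod_ite_zero, Finset.prod_const_one,
    Finset.mem_univ, true_imp_iff, funext_iff]

namespace CFCode

variable {X₁ X₂ Y : Type} [Fintype Y] {n M₁ M₂ L₁ L₂ K₁ K₂ : ℕ}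

/-- The word that encoder 1 sends for a message pair. -/
def input₁ (c : CFCode X₁ X₂ Y n M₁ M₂ L₁ L₂ K₁ K₂) (w : Fin M₁ × Fin M₂) : Fin n → X₁ :=
  c.f₁ w.1 (c.ψ₁ (c.φ₁ w.1) (c.φ₂ w.2))

/-- The word that encoder 2 sends for a message pair. -/
def input₂ (c : CFCode X₁ X₂ Y n M₁ M₂ L₁ L₂ K₁ K₂) (w : Fin M₁ × Fin M₂) : Fin n → X₂ :=
  c.f₂ w.2 (c.ψ₂ (c.φ₁ w.1) (c.φ₂ w.2))

theorem errorProb_le_maxError (c : CFCode X₁ X₂ Y n M₁ M₂ L₁ L₂ K₁ K₂) (W : DiscreteMAC X₁ X₂ Y)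
    (w : Fin M₁ × Fin M₂) : c.errorProb W w ≤ c.maxError W :=
  le_ciSup (f := c.errorProb W) (Set.finite_range _).bddAbove w

theorem maxError_eq_zero (c : CFCode X₁ X₂ Y n M₁ M₂ L₁ L₂ K₁ K₂) (W : DiscreteMAC X₁ X₂ Y)
    (h : ∀ w, c.errorProb W w = 0) : c.maxError W = 0 := by
  simp [maxError, h]

theorem errorProb_dueckMAC
    (c : CFCode DueckInput (Fin 2) (DueckOutput × Fin 2) n M₁ M₂ L₁ L₂ K₁ K₂)
    (w : Fin M₁ × Fin M₂) :
    c.errorProb dueckMAC w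
      = if c.g (dueckOutput (c.input₁ w) (c.input₂ w)) ≠ w then 1 else 0 := by
  rw [errorProb, Finset.sum_eq_single (dueckOutput (c.input₁ w) (c.input₂ w))]
  · rw [dueckMAC_ext, input₁, input₂, if_pos rfl]
  · intro y _ hy
    rw [dueckMAC_ext]
    simp only [input₁, input₂] at hy
    simp [hy]
  · simp

theorem injective_of_maxError_lt_one
    (c : CFCode DueckInput (Fin 2) (DueckOutput × Fin 2) n M₁ M₂ L₁ L₂ K₁ K₂)
    (h : c.maxError dueckMAC < 1) :
    Function.Injective fun w => dueckOutput (c.input₁ w) (c.input₂ w) := by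
  refine Function.LeftInverse.injective (g := c.g) fun w => ?_
  by_contra hw
  have := c.errorProb_le_maxError dueckMAC w
  rw [errorProb_dueckMAC, if_pos hw] at this
  linarith

end CFCode

/-! ### Message counts and rates -/

theorem one_le_rateSize {R : ℝ} (hR : 0 ≤ R) (n : ℕ) : 1 ≤ rateSize R n :=
  Nat.le_floor (by simpa using Real.one_le_rpow one_le_two (by positivity))

theorem rateSize_zero (n : ℕ) : rateSize 0 n = 1 := by simp [rateSize]

theorem rateSize_mono {R R' : ℝ} (h : R ≤ R') (n : ℕ) : rateSize R n ≤ rateSize R' n :=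
  Nat.floor_le_floor (Real.rpow_le_rpow_of_exponent_le one_le_two (by gcongr))

theorem rateSize_le (R : ℝ) (n : ℕ) : (rateSize R n : ℝ) ≤ ((2 : ℝ) ^ R) ^ n := by
  rw [← Real.rpow_mul_natCast zero_le_two, mul_comm]
  exact Nat.floor_le (by positivity)

theorem pow_le_two_mul_rateSize {R : ℝ} (hR : 0 ≤ R) (n : ℕ) :
    ((2 : ℝ) ^ R) ^ n ≤ 2 * rateSize R n := by
  have h1 := Nat.lt_floor_add_one ((2 : ℝ) ^ ((n : ℝ) * R))
  have h2 : (1 : ℝ) ≤ rateSize R n := by exact_mod_cast one_le_rateSize hR n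
  rw [← Real.rpow_mul_natCast zero_le_two, mul_comm]
  unfold rateSize at *
  linarith

theorem le_of_eventually_pow_le {a b C : ℝ} (hb : 0 < b)
    (h : ∀ᶠ n : ℕ in atTop, a ^ n ≤ C * b ^ n) : a ≤ b := by
  by_contra! hab
  have h1 := tendsto_pow_atTop_atTop_of_one_lt ((one_lt_div hb).2 hab)
  obtain ⟨n, hn, hn'⟩ := (h.and (h1.eventually_gt_atTop C)).exists
  rw [div_pow, lt_div_iff₀ (by positivity)] at hn'
  linarith

/-- A bound on the number of message pairs of zero-error codes bounds the sum-rate. -/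
theorem IsAchievableMax.two_rpow_le {Cin R : ℝ × ℝ} {K₁ K₂ : ℕ → ℕ} {b : ℝ} (hb : 0 < b)
    (hR : IsAchievableMax dueckMAC Cin K₁ K₂ R)
    (h : ∀ (n M₁ M₂ L₁ L₂ : ℕ)
      (c : CFCode DueckInput (Fin 2) (DueckOutput × Fin 2) n M₁ M₂ L₁ L₂ (K₁ n) (K₂ n)),
      (Function.Injective fun w => dueckOutput (c.input₁ w) (c.input₂ w)) →
        (M₁ * M₂ : ℝ) ≤ b ^ n) :
    (2 : ℝ) ^ (R.1 + R.2) ≤ b := by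
  obtain ⟨h1, h2, c, hc⟩ := hR
  -- Rounding in `rateSize` costs a factor of at most 2 per encoder.
  refine le_of_eventually_pow_le (C := 4) hb ?_
  filter_upwards [hc.eventually_lt_const one_pos] with n hn
  have := h _ _ _ _ _ (c n) ((c n).injective_of_maxError_lt_one hn)
  rw [Real.rpow_add two_pos, mul_pow]
  calc _ ≤ (2 * rateSize R.1 n : ℝ) * (2 * rateSize R.2 n) :=
        mul_le_mul (pow_le_two_mul_rateSize h1 n) (pow_le_two_mul_rateSize h2 n)
          (by positivity) (by positivity)
    _ = 4 * (rateSize R.1 n * rateSize R.2 n) := by ring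
    _ ≤ _ := by gcongr

/-- The output alphabet has 12 letters. This crude bound serves only to make the regions bounded. -/
theorem card_messages_le_pow_twelve {n M₁ M₂ L₁ L₂ K₁ K₂ : ℕ}
    (c : CFCode DueckInput (Fin 2) (DueckOutput × Fin 2) n M₁ M₂ L₁ L₂ K₁ K₂)
    (h : Function.Injective fun w => dueckOutput (c.input₁ w) (c.input₂ w)) :
    (M₁ * M₂ : ℝ) ≤ 12 ^ n := by
  have h1 := Fintype.card_le_of_injective _ h
  have h2 : Fintype.card DueckOutput = 6 := rfl
  simp only [Fintype.card_prod, Fintype.card_fin, Fintype.card_fun, h2] at h1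
  exact_mod_cast h1

/-! ### The converse without cooperation -/

/-- If u ≥ 2v, the products pu, pv, qu, qv are at most Q, Q/2, 2Q, Q. Otherwise p ≤ Q/u and q ≤ Q/v
give the factor (u+v)²/(uv) = 2 + u/v + v/u, which is at most 9/2 for 1 ≤ u/v ≤ 2. -/
theorem mul_add_le_of_mul_le {p q u v Q : ℝ} (hp : 0 ≤ p) (hv : 0 ≤ v) (hvu : v ≤ u)
    (hpu : p * u ≤ Q) (hqv : q * v ≤ Q) (hqu : q * u ≤ 2 * Q) :
    (p + q) * (u + v) ≤ 9 / 2 * Q := by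
  rcases le_total (2 * v) u with h | h
  · nlinarith [mul_nonneg hp (sub_nonneg.2 h)]
  · rcases hv.eq_or_lt with rfl | hv
    · have : u = 0 := by linarith
      subst this
      nlinarith
    · have hu : 0 < u := hv.trans_le hvu
      have hQ : 0 ≤ Q := le_trans (by positivity) hpu
      refine le_of_mul_le_mul_left ?_ (mul_pos hu hv)
      have h1 := mul_le_mul_of_nonneg_right hpu (sq_nonneg v)
      have h2 := mul_le_mul_of_nonneg_right hqv (sq_nonneg u)
      have h3 := mul_le_mul_of_nonneg_right hpu (mul_pos hu hv).le
      have h4 := mul_le_mul_of_nonneg_right hqv (mul_pos hu hv).le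
      -- (2v - u)(2u - v) ≥ 0 is the inequality 2(u+v)² ≤ 9uv.
      have h5 := mul_nonneg hQ (mul_nonneg (sub_nonneg.2 h) (by linarith : 0 ≤ 2 * u - v))
      nlinarith

/-- Where the first output letter carries no information on i, the tails must still separate, so the
induction hypothesis applies. This holds for a single first letter, and also for {a, b} against 0
and {A, B} against 1, which the channel merges. -/
theorem card_mul_card_le_of_injOn {ι κ : Type} [DecidableEq ι] [DecidableEq κ] {n : ℕ}
    (x : ι → Fin n → DueckInput) (v : κ → Fin n → Fin 2) (S : Finset ι) (T : Finset κ)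
    (hT : Set.InjOn v T) (hS : ∀ j ∈ T, Set.InjOn (fun i => dueckOutput (x i) (v j)) S) :
    (S.card * T.card : ℝ) ≤ (9 / 2) ^ n := by
  induction n generalizing S T with
  | zero =>
    have h1 : T.card ≤ 1 :=
      Finset.card_le_one.2 fun j hj j' hj' => hT hj hj' (Subsingleton.elim _ _)
    rcases T.eq_empty_or_nonempty with rfl | ⟨j, hj⟩
    · simp
    have h2 : S.card ≤ 1 :=
      Finset.card_le_one.2 fun i hi i' hi' => hS j hj hi hi' (Subsingleton.elim _ _)
    rw [pow_zero]
    exact_mod_cast Nat.mul_le_mul h2 h1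
  | succ n ih =>
    -- a pair of subfamilies with constant first output letter
    have key : ∀ S' ⊆ S, ∀ T' ⊆ T, (∀ j ∈ T', ∀ j' ∈ T', v j 0 = v j' 0) →
        (∀ j ∈ T', ∀ i ∈ S', ∀ i' ∈ S', dueckMap (x i 0) (v j 0) = dueckMap (x i' 0) (v j 0)) →
        (S'.card * T'.card : ℝ) ≤ (9 / 2) ^ n := by
      intro S' hS' T' hT' h1 h2
      refine ih (fun i => Fin.tail (x i)) (fun j => Fin.tail (v j)) S' T' ?_ ?_
      · intro j hj j' hj' h
        refine hT (hT' hj) (hT' hj') (funext fun t => ?_)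
        refine Fin.cases (h1 j hj j' hj') (fun t => congrFun h t) t
      · intro j hj i hi i' hi' h
        refine hS j (hT' hj) (hS' hi) (hS' hi') (funext fun t => ?_)
        exact Fin.cases (h2 j hj i hi i' hi') (fun t => congrFun h t) t
    let s : DueckInput → Finset ι := fun d => S.filter fun i => x i 0 = d
    let t : Fin 2 → Finset κ := fun d => T.filter fun j => v j 0 = d
    have hs : ∀ d d', d ≠ d' → ((s d ∪ s d').card : ℝ) = (s d).card + (s d').card := by
      intro d d' h
      rw [Finset.card_union_of_disjoint]
      · push_cast; rfl
      · exact Finset.disjoint_filter.2 fun i _ h1 h2 => h (h1.symm.trans h2)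
    have hcS : (S.card : ℝ) = (s .a).card + (s .b).card + ((s .A).card + (s .B).card) := by
      rw [Finset.card_eq_sum_card_fiberwise (f := fun i => x i 0) (t := Finset.univ) (by simp)]
      have : (Finset.univ : Finset DueckInput) = {.a, .b, .A, .B} := rfl
      simp [this, s]
      ring
    have hcT : (T.card : ℝ) = (t 0).card + (t 1).card := by
      rw [Finset.card_eq_sum_card_fiberwise (f := fun j => v j 0) (t := Finset.univ) (by simp)]
      simp [t]
    have k1 : ∀ d e, ((s d).card * (t e).card : ℝ) ≤ (9 / 2) ^ n := by
      intro d e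
      refine key _ (Finset.filter_subset _ _) _ (Finset.filter_subset _ _) ?_ ?_
      · simp +contextual [t]
      · simp +contextual
    have k2 : ∀ d d' e, d ≠ d' → dueckMap d e = dueckMap d' e →
        (((s d).card + (s d').card) * (t e).card : ℝ) ≤ (9 / 2) ^ n := by
      intro d d' e hd h
      rw [← hs d d' hd]
      refine key _ (Finset.union_subset (Finset.filter_subset _ _) (Finset.filter_subset _ _)) _
        (Finset.filter_subset _ _) ?_ ?_
      · simp +contextual [t]
      · intro j hj i hi i' hi'
        simp only [t, Finset.mem_filter] at hj
        simp only [Finset.mem_union, Finset.mem_filter] at hi hi'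
        rcases hi with ⟨_, hi⟩ | ⟨_, hi⟩ <;> rcases hi' with ⟨_, hi'⟩ | ⟨_, hi'⟩ <;>
          simp [hi, hi', hj.2, h]
    have p0 := k2 .a .b 0 (by decide) (by decide)
    have q1 := k2 .A .B 1 (by decide) (by decide)
    have a1 := k1 .a 1
    have b1 := k1 .b 1
    have A0 := k1 .A 0
    have B0 := k1 .B 0
    rw [hcS, hcT, pow_succ']
    -- The larger class of second words plays `u`; two single-letter bounds add up to the hypothesis
    -- with `2 * Q`.
    rcases le_total ((t 1).card : ℝ) (t 0).card with h | h
    · exact mul_add_le_of_mul_le (by positivity) (by positivity) h p0 q1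
        (by linarith)
    · rw [add_comm, add_comm ((t 0).card : ℝ)]
      exact mul_add_le_of_mul_le (by positivity) (by positivity) h q1 p0
        (by linarith)

/-- Without cooperation, zero-error codes for Dueck's MAC have at most `(9/2)^n` message pairs. -/
theorem card_messages_le_of_no_cooperation {n M₁ M₂ L₁ L₂ K₁ K₂ : ℕ} (hK₁ : K₁ = 1) (hK₂ : K₂ = 1)
    (c : CFCode DueckInput (Fin 2) (DueckOutput × Fin 2) n M₁ M₂ L₁ L₂ K₁ K₂)
    (h : Function.Injective fun w => dueckOutput (c.input₁ w) (c.input₂ w)) :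
    (M₁ * M₂ : ℝ) ≤ (9 / 2) ^ n := by
  subst hK₁ hK₂
  have e₁ : ∀ i j, c.input₁ (i, j) = c.f₁ i 0 := fun i j => by
    exact congrArg (c.f₁ i) (Subsingleton.elim _ _)
  have e₂ : ∀ i j, c.input₂ (i, j) = c.f₂ j 0 := fun i j =>
    congrArg (c.f₂ j) (Subsingleton.elim _ _)
  rcases M₁.eq_zero_or_pos with rfl | hM
  · simp only [Nat.cast_zero, zero_mul]; positivity
  have := card_mul_card_le_of_injOn (fun i => c.f₁ i 0) (fun j => c.f₂ j 0) Finset.univ Finset.univ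
    (fun j _ j' _ hj => ?_) (fun j _ i _ i' _ hi => ?_)
  · simpa using this
  · exact (Prod.ext_iff.1 (@h (⟨0, hM⟩, j) (⟨0, hM⟩, j') (by simp only [e₁, e₂]; exact congrArg _ hj))).2
  · exact (Prod.ext_iff.1 (@h (i, j) (i', j) (by simpa only [e₁, e₂] using hi))).1

/-! ### Random codebooks by counting -/

/-- If a random codebook is bad for each fixed `u` with probability at most `ε`, then some `J`
codebooks are such that every `u` has a good one among them. -/
theorem exists_forall_exists_not_of_card_le {C U : Type} [Fintype C] [Nonempty C] [Fintype U]
    (bad : C → U → Prop) [∀ c u, Decidable (bad c u)] {ε : ℝ} (J : ℕ)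
    (h : ∀ u, ((Finset.univ.filter fun c => bad c u).card : ℝ) ≤ ε * Fintype.card C)
    (hU : Fintype.card U * ε ^ J < 1) : ∃ c : Fin J → C, ∀ u, ∃ j, ¬ bad (c j) u := by
  classical
  by_contra! hc
  -- Union bound over `u`: a list fails at `u` when all its `J` independent entries are bad.
  have hsub : (Finset.univ : Finset (Fin J → C)) ⊆ Finset.univ.biUnion fun u : U =>
      Fintype.piFinset fun _ : Fin J => Finset.univ.filter fun c => bad c u := by
    intro c _
    obtain ⟨u, hu⟩ := hc c
    simp only [Finset.mem_biUnion, Fintype.mem_piFinset, Finset.mem_filter, Finset.mem_univ,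
      true_and]
    exact ⟨u, hu⟩
  have h1 := (Finset.card_le_card hsub).trans Finset.card_biUnion_le
  simp only [Finset.card_univ, Fintype.card_fun, Fintype.card_fin, Fintype.card_piFinset,
    Finset.prod_const] at h1
  have hC : (0 : ℝ) < Fintype.card C := by exact_mod_cast Fintype.card_pos
  have h2 : ((Fintype.card C : ℝ)) ^ J ≤ ∑ u : U, (ε * Fintype.card C) ^ J := by
    calc ((Fintype.card C : ℝ)) ^ J
        ≤ ∑ u : U, ((Finset.univ.filter fun c => bad c u).card : ℝ) ^ J := by exact_mod_cast h1
      _ ≤ _ := Finset.sum_le_sum fun u _ => pow_le_pow_left₀ (by positivity) (h u) J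
  simp only [Finset.sum_const, Finset.card_univ, nsmul_eq_mul, mul_pow] at h2
  nlinarith [pow_pos hC J]

/-- The number of functions whose values at two given points are related. -/
theorem card_filter_rel_mul_le {ι α : Type} [Fintype ι] [DecidableEq ι] [Fintype α]
    (r : α → α → Prop) [DecidableRel r] {i i' : ι} (hi : i ≠ i') :
    (Finset.univ.filter fun c : ι → α => r (c i) (c i')).card * Fintype.card α ^ 2
      ≤ Fintype.card (ι → α) * (Finset.univ.filter fun p : α × α => r p.1 p.2).card := by
  classical
  have : (Finset.univ.filter fun c : ι → α => r (c i) (c i')).card * Fintype.card α ^ 2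
      = ((Finset.univ.filter fun c : ι → α => r (c i) (c i')) ×ˢ
          (Finset.univ : Finset (α × α))).card := by
    rw [Finset.card_product, Finset.card_univ, Fintype.card_prod, sq]
  rw [this, ← Finset.card_univ, ← Finset.card_product]
  -- Exchanging the values at `i`, `i'` with an independent pair is injective: in a random function
  -- these two values are uniform on `α × α`.
  refine Finset.card_le_card_of_injOn
    (fun q => (Function.update (Function.update q.1 i q.2.1) i' q.2.2, (q.1 i, q.1 i'))) ?_ ?_
  · rintro ⟨c, a, b⟩ h
    simpa using h
  · rintro ⟨c, a, b⟩ _ ⟨c', a', b'⟩ _ h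
    simp only [Prod.mk.injEq] at h
    obtain ⟨h1, h2, h3⟩ := h
    have hk := fun k => congrFun h1 k
    have hb : b = b' := by simpa using hk i'
    have ha : a = a' := by simpa [hi] using hk i
    refine Prod.ext (funext fun k => ?_) (Prod.ext ha hb)
    by_cases hki : k = i
    · subst hki; exact h2
    by_cases hki' : k = i'
    · subst hki'; exact h3
    simpa [hki, hki'] using hk k

/-- Whatever the second input letter, exactly one pair of first letters is merged, so 4 + 2 = 6 of
the 16 ordered pairs collide in each position. -/
theorem card_collisions_le {n : ℕ} (v : Fin n → Fin 2) :
    (Finset.univ.filter fun p : (Fin n → DueckInput) × (Fin n → DueckInput) =>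
      dueckOutput p.1 v = dueckOutput p.2 v).card ≤ 6 ^ n := by
  have h6 : ∀ e : Fin 2, (Finset.univ.filter fun q : DueckInput × DueckInput =>
      dueckMap q.1 e = dueckMap q.2 e).card = 6 := by decide
  calc _ ≤ (Fintype.piFinset fun t => Finset.univ.filter fun q : DueckInput × DueckInput =>
      dueckMap q.1 (v t) = dueckMap q.2 (v t)).card := by
        refine Finset.card_le_card_of_injOn (fun p t => (p.1 t, p.2 t)) ?_ ?_
        · intro p hp
          simp only [Finset.coe_filter, Finset.mem_univ, true_and, Set.mem_ofPred_eq] at hp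
          simpa [dueckOutput] using fun t => congrFun hp t
        · intro p _ p' _ h
          exact Prod.ext (funext fun t => (Prod.ext_iff.1 (congrFun h t)).1)
            (funext fun t => (Prod.ext_iff.1 (congrFun h t)).2)
    _ = 6 ^ n := by simp [Fintype.card_piFinset, h6]

open Classical in
/-- For a uniformly random codebook of encoder 1, the probability that a given message is confused
with another one is at most `M * (3 / 8) ^ n`. -/
theorem card_confused_le {n M : ℕ} (i : Fin M) (v : Fin n → Fin 2) :
    ((Finset.univ.filter fun c : Fin M → Fin n → DueckInput =>
      ∃ i', i ≠ i' ∧ dueckOutput (c i) v = dueckOutput (c i') v).card : ℝ)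
      ≤ M * (3 / 8) ^ n * Fintype.card (Fin M → Fin n → DueckInput) := by
  have h1 : ∀ i', i ≠ i' → ((Finset.univ.filter fun c : Fin M → Fin n → DueckInput =>
      dueckOutput (c i) v = dueckOutput (c i') v).card : ℝ)
      ≤ (3 / 8) ^ n * Fintype.card (Fin M → Fin n → DueckInput) := by
    intro i' hi
    have h2 := card_filter_rel_mul_le (α := Fin n → DueckInput)
      (fun a b => dueckOutput a v = dueckOutput b v) hi
    have h3 := h2.trans (Nat.mul_le_mul_left _ (card_collisions_le v))
    have h4 : Fintype.card (Fin n → DueckInput) ^ 2 = 16 ^ n := by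
      rw [Fintype.card_fun, Fintype.card_fin, ← pow_mul, mul_comm, pow_mul]
      rfl
    rw [h4] at h3
    have h5 : (3 / 8 : ℝ) ^ n = 6 ^ n / 16 ^ n := by rw [← div_pow]; norm_num
    rw [h5, div_mul_eq_mul_div, le_div_iff₀ (by positivity), mul_comm (6 ^ n : ℝ)]
    exact_mod_cast h3
  calc _ ≤ (((Finset.univ.filter fun i' => i ≠ i').biUnion fun i' =>
          Finset.univ.filter fun c : Fin M → Fin n → DueckInput =>
            dueckOutput (c i) v = dueckOutput (c i') v).card : ℝ) := by
        gcongr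
        intro c
        simp
    _ ≤ ∑ i' ∈ Finset.univ.filter fun i' => i ≠ i',
          ((Finset.univ.filter fun c : Fin M → Fin n → DueckInput =>
            dueckOutput (c i) v = dueckOutput (c i') v).card : ℝ) := by
        exact_mod_cast Finset.card_biUnion_le
    _ ≤ ∑ i' ∈ Finset.univ.filter fun i' => i ≠ i',
          (3 / 8) ^ n * (Fintype.card (Fin M → Fin n → DueckInput) : ℝ) :=
        Finset.sum_le_sum fun i' hi' => h1 i' (by simpa using hi')
    _ ≤ _ := by
        rw [Finset.sum_const, nsmul_eq_mul, mul_assoc]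
        gcongr
        exact (Finset.card_filter_le _ _).trans (by simp)

/-! ### The zero-error code with a facilitator -/

theorem dueckMap_snd (x : DueckInput) (e : Fin 2) : (dueckMap x e).2 = e := by
  revert x e; decide

/-- A lower-case or an upper-case letter; the receiver always sees the case. -/
def caseLetter (e : Fin 2) : DueckInput := if e = 0 then .a else .A

theorem caseLetter_eq_of_dueckMap_eq {e e' : Fin 2} {d d' : Fin 2}
    (h : dueckMap (caseLetter e) d = dueckMap (caseLetter e') d') : e = e' := by
  revert e e' d d'; decide

/-- With `2 ^ k` codebooks at encoder 1 and `k` additional letters that tell the receiver which of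
them is in use, a facilitator that knows both messages enables zero-error transmission. -/
theorem exists_zero_error_code (k : ℕ) {n M₁ M₂ L₁ L₂ K₂ : ℕ} (hM₁ : 0 < M₁) (hM₂ : 0 < M₂)
    (hL₁ : M₁ ≤ L₁) (hL₂ : M₂ ≤ L₂) (hK₂ : 0 < K₂) (hn : M₂ ≤ 2 ^ n)
    (h : (M₁ * M₂ : ℝ) * (M₁ * (3 / 8) ^ n) ^ 2 ^ k < 1) :
    ∃ c : CFCode DueckInput (Fin 2) (DueckOutput × Fin 2) (n + k) M₁ M₂ L₁ L₂ (2 ^ k) K₂,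
      c.maxError dueckMAC = 0 := by
  classical
  have : NeZero M₁ := ⟨hM₁.ne'⟩
  have : NeZero M₂ := ⟨hM₂.ne'⟩
  obtain ⟨v⟩ : Nonempty (Fin M₂ ↪ (Fin n → Fin 2)) :=
    Function.Embedding.nonempty_of_card_le (by simpa using hn)
  have : Nonempty (Fin M₁ → Fin n → DueckInput) := ⟨fun _ _ => .a⟩
  obtain ⟨b, hb⟩ := exists_forall_exists_not_of_card_le
    (fun (c : Fin M₁ → Fin n → DueckInput) (u : Fin M₁ × Fin M₂) =>
      ∃ i', u.1 ≠ i' ∧ dueckOutput (c u.1) (v u.2) = dueckOutput (c i') (v u.2))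
    (2 ^ k) (fun u => card_confused_le u.1 (v u.2)) (by simpa using h)
  choose J hJ using hb
  push Not at hJ
  -- The final letters spell the binary digits of the codebook index `j` in their case.
  let x₁ : Fin M₁ → Fin (2 ^ k) → Fin (n + k) → DueckInput := fun i j =>
    Fin.append (b j i) (fun t => caseLetter (finFunctionFinEquiv.symm j t))
  let x₂ : Fin M₂ → Fin (n + k) → Fin 2 := fun i => Fin.append (v i) (fun _ => 0)
  let out : Fin M₁ × Fin M₂ → Fin (n + k) → DueckOutput × Fin 2 := fun w =>
    dueckOutput (x₁ w.1 (J w)) (x₂ w.2)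
  have hinj : Function.Injective out := by
    rintro ⟨i, j⟩ ⟨i', j'⟩ hw
    have hl : dueckOutput (b (J (i, j)) i) (v j) = dueckOutput (b (J (i', j')) i') (v j') := by
      funext t
      simpa [out, x₁, x₂, dueckOutput] using congrFun hw (Fin.castAdd k t)
    have hj : j = j' := v.injective <| funext fun t => by
      simpa [dueckOutput, dueckMap_snd] using congrArg Prod.snd (congrFun hl t)
    subst hj
    have hJJ : J (i, j) = J (i', j) := by
      refine finFunctionFinEquiv.symm.injective (funext fun t => ?_)
      have := congrFun hw (Fin.natAdd n t)
      simp only [out, x₁, x₂, dueckOutput, Fin.append_right] at this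
      exact caseLetter_eq_of_dueckMap_eq this
    -- Both words now come from the codebook chosen as unambiguous for `(i, j)`.
    by_contra hne
    refine hJ (i, j) i' (fun hi => hne (by rw [show i = i' from hi])) ?_
    rw [hl, hJJ]
  let c : CFCode DueckInput (Fin 2) (DueckOutput × Fin 2) (n + k) M₁ M₂ L₁ L₂ (2 ^ k) K₂ :=
    { φ₁ := Fin.castLE hL₁
      φ₂ := Fin.castLE hL₂
      ψ₁ := fun l₁ l₂ =>
        J (Function.invFun (Fin.castLE hL₁) l₁, Function.invFun (Fin.castLE hL₂) l₂)
      ψ₂ := fun _ _ => ⟨0, hK₂⟩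
      f₁ := x₁
      f₂ := fun i _ => x₂ i
      g := Function.invFun out }
  refine ⟨c, c.maxError_eq_zero _ fun w => ?_⟩
  have h1 : c.input₁ w = x₁ w.1 (J w) := by
    simp only [CFCode.input₁, c]
    rw [Function.leftInverse_invFun (Fin.castLE_injective hL₁),
      Function.leftInverse_invFun (Fin.castLE_injective hL₂)]
  rw [CFCode.errorProb_dueckMAC, if_neg]
  rw [not_not, h1]
  exact Function.leftInverse_invFun hinj w

/-! ### Achievable rate pairs -/

theorem CFCode.nonempty {X₁ X₂ Y : Type} [Fintype Y] [Nonempty X₁] [Nonempty X₂]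
    {n M₁ M₂ L₁ L₂ K₁ K₂ : ℕ} (hM₁ : 1 ≤ M₁) (hM₂ : 1 ≤ M₂) (hL₁ : 1 ≤ L₁) (hL₂ : 1 ≤ L₂)
    (hK₁ : 1 ≤ K₁) (hK₂ : 1 ≤ K₂) : Nonempty (CFCode X₁ X₂ Y n M₁ M₂ L₁ L₂ K₁ K₂) :=
  ⟨{ φ₁ := fun _ => ⟨0, hL₁⟩
     φ₂ := fun _ => ⟨0, hL₂⟩
     ψ₁ := fun _ _ => ⟨0, hK₁⟩
     ψ₂ := fun _ _ => ⟨0, hK₂⟩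
     f₁ := fun _ _ _ => Classical.arbitrary X₁
     f₂ := fun _ _ _ => Classical.arbitrary X₂
     g := fun _ => (⟨0, hM₁⟩, ⟨0, hM₂⟩) }⟩

instance : Nonempty DueckInput := ⟨.a⟩

/-- The limit ignores small blocklengths, which take an arbitrary code. -/
theorem isAchievableMax_of_eventually {Cin R : ℝ × ℝ} {K₁ K₂ : ℕ → ℕ} (hCin₁ : 0 ≤ Cin.1)
    (hCin₂ : 0 ≤ Cin.2) (hK₁ : ∀ n, 1 ≤ K₁ n) (hK₂ : ∀ n, 1 ≤ K₂ n) (hR₁ : 0 ≤ R.1) (hR₂ : 0 ≤ R.2)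
    (h : ∀ᶠ n in atTop, ∃ c : CFCode DueckInput (Fin 2) (DueckOutput × Fin 2) n (rateSize R.1 n)
      (rateSize R.2 n) (rateSize Cin.1 n) (rateSize Cin.2 n) (K₁ n) (K₂ n),
      c.maxError dueckMAC = 0) : IsAchievableMax dueckMAC Cin K₁ K₂ R := by
  have hc : ∀ n, ∃ c : CFCode DueckInput (Fin 2) (DueckOutput × Fin 2) n (rateSize R.1 n)
      (rateSize R.2 n) (rateSize Cin.1 n) (rateSize Cin.2 n) (K₁ n) (K₂ n),
      (∃ c' : CFCode DueckInput (Fin 2) (DueckOutput × Fin 2) n (rateSize R.1 n)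
        (rateSize R.2 n) (rateSize Cin.1 n) (rateSize Cin.2 n) (K₁ n) (K₂ n),
        c'.maxError dueckMAC = 0) → c.maxError dueckMAC = 0 := by
    intro n
    by_cases hn : ∃ c' : CFCode DueckInput (Fin 2) (DueckOutput × Fin 2) n (rateSize R.1 n)
        (rateSize R.2 n) (rateSize Cin.1 n) (rateSize Cin.2 n) (K₁ n) (K₂ n),
        c'.maxError dueckMAC = 0
    · exact hn.imp fun c hc _ => hc
    · obtain ⟨c⟩ : Nonempty (CFCode DueckInput (Fin 2) (DueckOutput × Fin 2) n (rateSize R.1 n)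
        (rateSize R.2 n) (rateSize Cin.1 n) (rateSize Cin.2 n) (K₁ n) (K₂ n)) :=
        CFCode.nonempty (one_le_rateSize hR₁ n) (one_le_rateSize hR₂ n) (one_le_rateSize hCin₁ n)
          (one_le_rateSize hCin₂ n) (hK₁ n) (hK₂ n)
      exact ⟨c, fun h => absurd h hn⟩
  choose c hc using hc
  refine ⟨hR₁, hR₂, c, tendsto_const_nhds.congr' ?_⟩
  filter_upwards [h] with n hn
  exact (hc n hn).symm

theorem isAchievableMax_zero {Cin : ℝ × ℝ} {K₁ K₂ : ℕ → ℕ} (hCin₁ : 0 ≤ Cin.1)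
    (hCin₂ : 0 ≤ Cin.2) (hK₁ : ∀ n, 1 ≤ K₁ n) (hK₂ : ∀ n, 1 ≤ K₂ n) :
    IsAchievableMax dueckMAC Cin K₁ K₂ (0, 0) := by
  refine isAchievableMax_of_eventually hCin₁ hCin₂ hK₁ hK₂ le_rfl le_rfl (.of_forall fun n => ?_)
  obtain ⟨c⟩ := CFCode.nonempty (X₁ := DueckInput) (X₂ := Fin 2) (Y := DueckOutput × Fin 2) (n := n)
    (one_le_rateSize le_rfl n) (one_le_rateSize le_rfl n) (one_le_rateSize hCin₁ n)
    (one_le_rateSize hCin₂ n) (hK₁ n) (hK₂ n)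
  refine ⟨c, c.maxError_eq_zero _ fun w => ?_⟩
  have : Subsingleton (Fin (rateSize 0 n)) := by rw [rateSize_zero]; infer_instance
  rw [CFCode.errorProb_dueckMAC, if_neg (not_not.2 (Subsingleton.elim _ _))]

theorem isAchievableMax_six_bits {Cin : ℝ × ℝ} (hCin₁ : 2 ≤ Cin.1) (hCin₂ : 1 ≤ Cin.2) :
    IsAchievableMax dueckMAC Cin (fun _ => 2 ^ 6) (fun _ => 2 ^ 6) (5 / 4, 19 / 20) := by
  refine isAchievableMax_of_eventually (by linarith) (by linarith) (fun _ => by norm_num)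
    (fun _ => by norm_num) (by norm_num) (by norm_num) ?_
  -- Here 12/5 exceeds 2^(5/4), the factor 2 covers encoder 2, and 12/5 · 3/8 = 9/10. The remaining
  -- factors come from the six extra letters.
  have ht : Tendsto (fun n : ℕ => (12 / 5 * 2) ^ 6 * ((12 / 5) ^ 6) ^ 64 *
      ((12 / 5 * 2) * (9 / 10) ^ 64 : ℝ) ^ n) atTop (𝓝 0) := by
    simpa using (tendsto_pow_atTop_nhds_zero_of_lt_one (r := ((12 / 5 * 2) * (9 / 10) ^ 64 : ℝ))
      (by positivity) (by norm_num)).const_mul ((12 / 5 * 2) ^ 6 * ((12 / 5) ^ 6) ^ 64 : ℝ)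
  rw [← map_add_atTop_eq_nat 6, eventually_map]
  -- 19/20 · (n + 6) ≤ n needs n ≥ 114.
  filter_upwards [ht.eventually_lt_const one_pos, eventually_ge_atTop 120] with n hn hn'
  have hM₁ : (rateSize (5 / 4) (n + 6) : ℝ) ≤ (12 / 5) ^ (n + 6) := by
    refine (rateSize_le _ _).trans (pow_le_pow_left₀ (by positivity) ?_ _)
    -- Fourth powers: 2^5 = 32 < (12/5)^4.
    refine le_of_pow_le_pow_left₀ (n := 4) (by norm_num) (by norm_num) ?_
    rw [← Real.rpow_mul_natCast zero_le_two]
    norm_num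
  have hM₂ : rateSize (19 / 20) (n + 6) ≤ 2 ^ n := by
    refine Nat.floor_le_of_le ?_
    push_cast
    rw [← Real.rpow_natCast]
    refine Real.rpow_le_rpow_of_exponent_le one_le_two ?_
    have : (120 : ℝ) ≤ n := by exact_mod_cast hn'
    linarith
  refine exists_zero_error_code 6 (one_le_rateSize (by norm_num) _)
    (one_le_rateSize (by norm_num) _) (rateSize_mono (by linarith) _)
    (rateSize_mono (by linarith) _) (by norm_num) hM₂ (lt_of_le_of_lt ?_ hn)
  have hM₂' : (rateSize (19 / 20) (n + 6) : ℝ) ≤ 2 ^ (n + 6) := by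
    refine (Nat.cast_le.2 hM₂).trans ?_
    push_cast
    exact pow_le_pow_right₀ one_le_two (by omega)
  calc _ ≤ ((12 / 5) ^ (n + 6) * 2 ^ (n + 6) : ℝ) * ((12 / 5) ^ (n + 6) * (3 / 8) ^ n) ^ 2 ^ 6 := by
        gcongr
    _ = _ := by
        have h1 : ((12 / 5) ^ (n + 6) * (3 / 8) ^ n : ℝ) = (12 / 5) ^ 6 * (9 / 10) ^ n := by
          rw [pow_add, mul_right_comm, ← mul_pow, mul_comm]; norm_num
        have h2 : (2 : ℕ) ^ 6 = 64 := by norm_num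
        rw [h1, h2, ← mul_pow, pow_add _ n 6, mul_pow _ _ 64, mul_pow _ (_ ^ 64) n,
          pow_right_comm (9 / 10 : ℝ) n 64]
        generalize ((12 / 5 : ℝ) ^ 6) ^ 64 = x, (12 / 5 * 2 : ℝ) ^ n = y,
          ((9 / 10 : ℝ) ^ 64) ^ n = z
        ring

/-! ### Comparison of the sum-capacities -/

theorem isCompact_closure_achievable {Cin : ℝ × ℝ} {K₁ K₂ : ℕ → ℕ} :
    IsCompact (closure {R | IsAchievableMax dueckMAC Cin K₁ K₂ R}) := by
  refine Bornology.IsBounded.isCompact_closure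
    ((Metric.isBounded_Icc ((0, 0) : ℝ × ℝ) (4, 4)).subset fun R hR => ?_)
  have h1 := hR.two_rpow_le (b := 12) (by norm_num) fun n M₁ M₂ L₁ L₂ c =>
    card_messages_le_pow_twelve c
  have h2 : R.1 + R.2 ≤ 4 := by
    rw [← Real.rpow_le_rpow_left_iff one_lt_two]
    exact h1.trans (by norm_num)
  have h3 := hR.1
  have h4 := hR.2.1
  exact ⟨⟨h3, h4⟩, ⟨by simp only; linarith, by simp only; linarith⟩⟩

theorem isGreatest_sumRates {S : Set (ℝ × ℝ)} (hS : IsCompact S) (hne : S.Nonempty) :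
    IsGreatest (sumRates S) (sSup (sumRates S)) :=
  (hS.image (continuous_fst.add continuous_snd)).isGreatest_sSup (hne.image _)

theorem sumCapacityMax_no_cooperation_le {Cin : ℝ × ℝ} (hCin₁ : 0 ≤ Cin.1) (hCin₂ : 0 ≤ Cin.2) :
    sumCapacityMax dueckMAC Cin (0, 0) ≤ Real.logb 2 (9 / 2) := by
  have hne : (capacityRegionMax dueckMAC Cin (0, 0)).Nonempty :=
    ⟨_, subset_closure (isAchievableMax_zero hCin₁ hCin₂ (one_le_rateSize le_rfl)
      (one_le_rateSize le_rfl))⟩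
  refine csSup_le (hne.image _) ?_
  rintro _ ⟨R, hR, rfl⟩
  refine closure_minimal (t := {R : ℝ × ℝ | R.1 + R.2 ≤ Real.logb 2 (9 / 2)}) (fun R hR => ?_)
    (isClosed_le (continuous_fst.add continuous_snd) continuous_const) hR
  rw [Set.mem_ofPred_eq, Real.le_logb_iff_rpow_le one_lt_two (by norm_num)]
  exact hR.two_rpow_le (by norm_num) fun n M₁ M₂ L₁ L₂ c =>
    card_messages_le_of_no_cooperation (rateSize_zero n) (rateSize_zero n) c

theorem logb_two_lt : Real.logb 2 (9 / 2) < 5 / 4 + 19 / 20 := by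
  rw [Real.logb_lt_iff_lt_rpow one_lt_two (by norm_num)]
  -- Fifth powers: (9/2)^5 < 1846 < 2048 = 2^11.
  refine lt_of_pow_lt_pow_left₀ 5 (by positivity) ?_
  rw [← Real.rpow_mul_natCast zero_le_two]
  norm_num

theorem mainTheorem2 (Cin : ℝ × ℝ) (hCin₁ : 2 ≤ Cin.1) (hCin₂ : 1 ≤ Cin.2) :
    IsGreatest (sumRates (capacityRegionMax dueckMAC Cin (0, 0)))
        (sumCapacityMax dueckMAC Cin (0, 0)) ∧
      IsGreatest (sumRates (capacityRegionMaxBits dueckMAC Cin 6))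
        (sumCapacityMaxBits dueckMAC Cin 6) ∧
      sumCapacityMax dueckMAC Cin (0, 0) < sumCapacityMaxBits dueckMAC Cin 6 := by
  have h1 : 0 ≤ Cin.1 := by linarith
  have h2 : 0 ≤ Cin.2 := by linarith
  have h6 : (5 / 4, 19 / 20) ∈ capacityRegionMaxBits dueckMAC Cin 6 :=
    subset_closure (isAchievableMax_six_bits hCin₁ hCin₂)
  have hG : IsGreatest (sumRates (capacityRegionMaxBits dueckMAC Cin 6))
      (sumCapacityMaxBits dueckMAC Cin 6) :=
    isGreatest_sumRates isCompact_closure_achievable ⟨_, h6⟩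
  refine ⟨isGreatest_sumRates isCompact_closure_achievable ⟨_, subset_closure
    (isAchievableMax_zero h1 h2 (one_le_rateSize le_rfl) (one_le_rateSize le_rfl))⟩, hG, ?_⟩
  exact (sumCapacityMax_no_cooperation_le h1 h2).trans_lt
    (logb_two_lt.trans_le (hG.2 ⟨_, h6, rfl⟩))
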